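/- Let $1\le p\le m\le n$ be integers. Consider $n$ agents $x_1,\dots,x_n$ and $m$ observers $y_1,\dots,y_m$. A structural matrix is a pattern that makes some entries free real parameters (the nonzero entries) and fixes all the others to be $0$; its number of nonzero entries is written $\|\cdot\|_0$. A design is a pair of structural matrices $[A]$ (size $n\times n$) and $[C]$ (size $m\times n$) such that every agent has a self loop, i.e. $[A]_{ii}\ne0$ for all $i$, each observer measures exactly one agent (each row of $[C]$ has exactly one nonzero entry), and no two observers measure the same agent (each column of $[C]$ has at most one nonzero entry). The graph of the design has an edge $x_j\to x_i$ when $[A]_{ij}\neq 0$ and an edge $x_j\to y_i$ when $[C]_{ij}\ne 0$. For a set $F$ of compromised nodes (agents or observers), with one attack input per element of $F$, let $[B^a]$ (size $n\times|F|$) and $[D^a]$ (size $m\times|F|$) be the structural matrices whose nonzero entries connect the input of each compromised agent to that agent, respectively the input of each compromised observer to that observer. A numerical system $x(k+1)=Ax(k)+Bu(k)$, $y(k)=Cx(k)+Du(k)$ is left invertible if $x(0)=0$ and $y(k)=0$ for all $k\ge 0$ imply $u(k)=0$ for all $k\ge 0$. The structural system $([A],[B^a],[C],[D^a])$ is structurally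 left invertible if its realizations are left invertible for all values of the free parameters outside a set of Lebesgue measure $0$. Let $\mathcal F_{xy}$ be the set of all sets $F$ of at most $p$ nodes. A design is feasible if $([A],[B^a],[C],[D^a])$ is structurally left invertible for every $F\in\mathcal F_{xy}$. **Theorem.** The minimum of $\|A\|_0$ over all feasible designs is attained and equals $$\|A\|_0^*=mp+(n-m)(p+1)=np+n-m.$$ Moreover, let $[C]$ be any choice of $m$ distinct observed agents, one per observer. Then there are $[A]$ such that every agent has a self loop and out-degree $p+1$, and all its out-neighbours other than itself and its observer (if it has one) are observed agents. Every such $[A]$ gives a feasible design that attains the minimum. -/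

import Mathlib

open MeasureTheory

namespace StructuralAttack

/-- A structural matrix with rows `ι` and columns `κ`, given by the finite set of its nonzero
positions: `(i, j) ∈ S` means that the entry `(i, j)` is a free real parameter, and
`(i, j) ∉ S` means that this entry is fixed to be `0`. -/
abbrev StructMatrix (ι κ : Type*) := Finset (ι × κ)

/-- The numerical matrix obtained from a structural matrix by giving values to its free
parameters. -/
def StructMatrix.realize {ι κ : Type*} [DecidableEq ι] [DecidableEq κ]
    (S : StructMatrix ι κ) (θ : S → ℝ) : Matrix ι κ ℝ :=
  fun i j => if h : (i, j) ∈ S then θ ⟨(i, j), h⟩ else 0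

/-- The system `x (k+1) = A x k + B u k`, `y k = C x k + D u k` is left invertible: starting from
`x 0 = 0`, identically zero output forces identically zero input. -/
def LeftInvertible {X U Y : Type*} [Fintype X] [Fintype U]
    (A : Matrix X X ℝ) (B : Matrix X U ℝ) (C : Matrix Y X ℝ) (D : Matrix Y U ℝ) : Prop :=
  ∀ (x : ℕ → X → ℝ) (u : ℕ → U → ℝ) (y : ℕ → Y → ℝ),
    x 0 = 0 →
    (∀ k, x (k + 1) = A.mulVec (x k) + B.mulVec (u k)) →
    (∀ k, y k = C.mulVec (x k) + D.mulVec (u k)) →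
    (∀ k, y k = 0) → ∀ k, u k = 0

/-- The structural system is structurally left invertible: all its numerical realizations are left
invertible, except for a set of parameter values of Lebesgue measure zero. -/
def StructurallyLeftInvertible {X U Y : Type*} [Fintype X] [Fintype U]
    [DecidableEq X] [DecidableEq U] [DecidableEq Y]
    (A : StructMatrix X X) (B : StructMatrix X U)
    (C : StructMatrix Y X) (D : StructMatrix Y U) : Prop :=
  ∀ᵐ θ : (A → ℝ) × (B → ℝ) × (C → ℝ) × (D → ℝ),
    LeftInvertible (A.realize θ.1) (B.realize θ.2.1) (C.realize θ.2.2.1) (D.realize θ.2.2.2)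

/-- Vertices of the network: `n` agents (`Sum.inl`) and `m` observers (`Sum.inr`). -/
abbrev Node (n m : ℕ) := Fin n ⊕ Fin m

/-- The structural matrix `[Bᵃ]` when the nodes in `F` are compromised. There is one attack input
for each compromised node; the entry at agent `i` and the input of node `v` is nonzero exactly
when `v` is the agent `i`. -/
def attackB {n m : ℕ} (F : Finset (Node n m)) : StructMatrix (Fin n) F :=
  Finset.univ.filter fun e => e.2.1 = Sum.inl e.1

/-- The structural matrix `[Dᵃ]` when the nodes in `F` are compromised: the entry at observer `i`
and the input of node `v` is nonzero exactly when `v` is the observer `i`. -/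
def attackD {n m : ℕ} (F : Finset (Node n m)) : StructMatrix (Fin m) F :=
  Finset.univ.filter fun e => e.2.1 = Sum.inr e.1

/-- Every agent has a self loop. -/
def HasSelfLoops {n : ℕ} (A : StructMatrix (Fin n) (Fin n)) : Prop :=
  ∀ j, (j, j) ∈ A

/-- Each observer measures exactly one agent, and no two observers measure the same agent. -/
def DedicatedSensors {n m : ℕ} (C : StructMatrix (Fin m) (Fin n)) : Prop :=
  (∀ i, ∃! j, (i, j) ∈ C) ∧ ∀ i i' j, (i, j) ∈ C → (i', j) ∈ C → i = i'

/-- Structural left invertibility for every set `F` of at most `p` compromised nodes, which may be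
agents or observers. -/
def RobustToAttacks {n m : ℕ} (p : ℕ)
    (A : StructMatrix (Fin n) (Fin n)) (C : StructMatrix (Fin m) (Fin n)) : Prop :=
  ∀ F : Finset (Node n m), F.card ≤ p →
    StructurallyLeftInvertible A (attackB F) C (attackD F)

/-- The feasible designs `([A], [C])` of the optimization problem. -/
def Feasible {n m : ℕ} (p : ℕ)
    (A : StructMatrix (Fin n) (Fin n)) (C : StructMatrix (Fin m) (Fin n)) : Prop :=
  HasSelfLoops A ∧ DedicatedSensors C ∧ RobustToAttacks p A C

/-- The agent `j` is measured by some observer. -/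
def Observed {n m : ℕ} (C : StructMatrix (Fin m) (Fin n)) (j : Fin n) : Prop :=
  ∃ i, (i, j) ∈ C

/-- The out-degree of agent `j` in the network graph, in which there is an edge from agent `j` to
agent `k` when `(k, j) ∈ A`, and to observer `i` when `(i, j) ∈ C`. -/
def outDegree {n m : ℕ} (A : StructMatrix (Fin n) (Fin n)) (C : StructMatrix (Fin m) (Fin n))
    (j : Fin n) : ℕ :=
  (Finset.univ.filter fun k : Fin n => (k, j) ∈ A).card +
    (Finset.univ.filter fun i : Fin m => (i, j) ∈ C).card

/-- The explicit designs: every agent has a self loop and out-degree `p + 1`, and sends its state,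
apart from itself and its observer (if it has one), only to observed agents. -/
def IsExplicitDesign {n m : ℕ} (p : ℕ)
    (A : StructMatrix (Fin n) (Fin n)) (C : StructMatrix (Fin m) (Fin n)) : Prop :=
  HasSelfLoops A ∧ (∀ j k, (k, j) ∈ A → k = j ∨ Observed C k) ∧ ∀ j, outDegree A C j = p + 1

end StructuralAttack

/-! Lower bound: if an agent and all its out-neighbours are compromised, the attacker can set that
agent's state to 1 and cancel everything it emits one step later, so no output ever moves. With the
self loop counted, feasibility thus forces out-degree at least `p + 1` (`lt_outDegree`). Out-degrees
sum to `A.card + m`, because each observer has one incoming edge.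

Attainment: generic left invertibility needs only one realization whose system matrix at `w = 1` has
trivial kernel (`structurallyLeftInvertible_of_realization`). Such a realization comes from matching
the compromised agents that lack an intact sensor to distinct intact measured agents
(`structurallyLeftInvertible_of_matching`). In an explicit design each agent has `p` observed
out-neighbours, and `F.card ≤ p` leaves enough of them for Hall's theorem. -/

namespace StructuralAttack

/-! ### Generic nonvanishing -/

open Polynomial in
/-- A continuous function that is polynomial along every line through a point where it does not
vanish is nonzero almost everywhere. -/
theorem ae_ne_zero_of_polynomial_on_lines {E : Type*} [NormedAddCommGroup E] [NormedSpace ℝ E]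
    [FiniteDimensional ℝ E] [MeasurableSpace E] [BorelSpace E] (μ : Measure E)
    [μ.IsAddHaarMeasure] {f : E → ℝ} (hf : Continuous f) (a : E) (ha : f a ≠ 0)
    (hp : ∀ v, ∃ q : ℝ[X], ∀ t, q.eval t = f (a + t • v)) : ∀ᵐ z ∂μ, f z ≠ 0 := by
  have hline : ∀ v, ∀ᵐ t : ℝ, f (a + t • v) ≠ 0 := by
    intro v
    obtain ⟨q, hq⟩ := hp v
    have hq0 : q ≠ 0 := by
      rintro rfl
      exact ha (by simpa using (hq 0).symm)
    refine measure_mono_null (fun t ht => ?_) (q.roots.toFinset.finite_toSet.measure_zero volume)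
    have : f (a + t • v) = 0 := by simpa using ht
    simp [hq0, hq, this]
  have hmeas : MeasurableSet {z : E × ℝ | f (a + z.2 • z.1) ≠ 0} :=
    ((isOpen_ne (x := (0 : ℝ))).preimage (by fun_prop : Continuous
      fun z : E × ℝ => f (a + z.2 • z.1))).measurableSet
  -- By Fubini some `t ≠ 0` works for almost every direction; dilation by `t` and translation by `a`
  -- preserve null sets.
  have hswap : ∀ᵐ t : ℝ, ∀ᵐ v ∂μ, f (a + t • v) ≠ 0 :=
    (Measure.ae_ae_comm (p := fun v (t : ℝ) => f (a + t • v) ≠ 0) hmeas).1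
      (Filter.Eventually.of_forall hline)
  obtain ⟨t, ht, ht0⟩ := (hswap.and (Measure.ae_ne volume (0 : ℝ))).exists
  have h1 : μ ((t • ·) ⁻¹' {w | f (a + w) = 0}) = 0 := by
    simpa [ae_iff] using ht
  rw [Measure.addHaar_preimage_smul μ ht0] at h1
  have h2 : μ {w | f (a + w) = 0} = 0 := by
    rcases mul_eq_zero.1 h1 with h | h
    · exact absurd h (by simp [ht0])
    · exact h
  rw [ae_iff]
  simpa using (measure_preimage_add μ a {z | f z = 0}).symm.trans h2

/-! ### Left invertibility from a Gram determinant -/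

section Matrices

variable {X U Y R : Type*} [Fintype X] [Fintype U] [Fintype Y] [DecidableEq X] [DecidableEq U]
  [CommRing R]

/-- The system matrix in the variable `w = z⁻¹`. -/
def systemMatrix (w : R) (A : Matrix X X R) (B : Matrix X U R) (C : Matrix Y X R)
    (D : Matrix Y U R) : Matrix (X ⊕ Y) (X ⊕ U) R :=
  Matrix.fromBlocks (1 - w • A) (-(w • B)) C D

/-- The Gram determinant of the system matrix. -/
def systemGram (w : R) (A : Matrix X X R) (B : Matrix X U R) (C : Matrix Y X R)
    (D : Matrix Y U R) : R :=
  ((systemMatrix w A B C D).transpose * systemMatrix w A B C D).det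

/-- This lets the same determinant be compared over `ℝ`, polynomials and power series. -/
theorem map_systemGram {S : Type*} [CommRing S] (φ : R →+* S) (w : R) (A : Matrix X X R)
    (B : Matrix X U R) (C : Matrix Y X R) (D : Matrix Y U R) :
    φ (systemGram w A B C D) = systemGram (φ w) (A.map φ) (B.map φ) (C.map φ) (D.map φ) := by
  have h : (systemMatrix w A B C D).map φ =
      systemMatrix (φ w) (A.map φ) (B.map φ) (C.map φ) (D.map φ) := by
    simp only [systemMatrix, Matrix.fromBlocks_map]
    congr 1
    · ext i j
      simp [Matrix.one_apply, apply_ite φ]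
    · ext i j
      simp
  simp only [systemGram]
  rw [RingHom.map_det, RingHom.mapMatrix_apply, Matrix.map_mul, Matrix.transpose_map, h]

theorem eq_zero_of_systemGram_ne_zero [IsDomain R] {w : R} {A : Matrix X X R} {B : Matrix X U R}
    {C : Matrix Y X R} {D : Matrix Y U R} (h : systemGram w A B C D ≠ 0) {x : X → R} {u : U → R}
    (hx : x = w • (A.mulVec x + B.mulVec u)) (hy : C.mulVec x + D.mulVec u = 0) : u = 0 := by
  have hM : (systemMatrix w A B C D).mulVec (Sum.elim x u) = 0 := by
    rw [systemMatrix, Matrix.fromBlocks_mulVec]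
    simp only [Sum.elim_comp_inl, Sum.elim_comp_inr, hy, Matrix.sub_mulVec, Matrix.one_mulVec,
      Matrix.neg_mulVec, Matrix.smul_mulVec]
    have : x - w • A.mulVec x + -(w • B.mulVec u) = 0 := by
      nth_rewrite 1 [hx]
      rw [smul_add]
      abel
    rw [this]
    ext i
    cases i <;> rfl
  have := Matrix.eq_zero_of_mulVec_eq_zero h
    (show _ = 0 by rw [← Matrix.mulVec_mulVec, hM, Matrix.mulVec_zero])
  ext i
  exact congrFun this (Sum.inr i)

theorem systemGram_ne_zero {A : Matrix X X ℝ} {B : Matrix X U ℝ} {C : Matrix Y X ℝ}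
    {D : Matrix Y U ℝ}
    (h : ∀ x u, x = A.mulVec x + B.mulVec u → C.mulVec x + D.mulVec u = 0 → x = 0 ∧ u = 0) :
    systemGram 1 A B C D ≠ 0 := by
  intro h0
  obtain ⟨v, hv0, hv⟩ := Matrix.exists_mulVec_eq_zero_iff.2 h0
  have hM : (systemMatrix 1 A B C D).mulVec v = 0 := by
    have : v ∈ LinearMap.ker
        (Matrix.mulVecLin ((systemMatrix 1 A B C D).transpose * systemMatrix 1 A B C D)) := hv
    rw [Matrix.ker_mulVecLin_transpose_mul_self] at this
    exact this
  rw [systemMatrix, Matrix.fromBlocks_mulVec] at hM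
  have hl : ∀ i, _ = (0 : ℝ) := fun i => congrFun hM (Sum.inl i)
  have hr : ∀ i, _ = (0 : ℝ) := fun i => congrFun hM (Sum.inr i)
  simp only [Sum.elim_inl, Sum.elim_inr, one_smul, Matrix.sub_mulVec, Matrix.one_mulVec,
    Matrix.neg_mulVec, Pi.add_apply, Pi.sub_apply, Pi.neg_apply] at hl hr
  obtain ⟨hx, hu⟩ := h (v ∘ Sum.inl) (v ∘ Sum.inr)
    (funext fun i => by have := hl i; simp only [Pi.add_apply]; linarith)
    (funext fun i => hr i)
  refine hv0 (funext fun i => ?_)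
  cases i with
  | inl i => exact congrFun hx i
  | inr i => exact congrFun hu i

/-- The generating function of a sequence of vectors. -/
def genFun {ι : Type*} (x : ℕ → ι → ℝ) : ι → PowerSeries ℝ :=
  fun i => PowerSeries.mk fun k => x k i

theorem coeff_mulVec_genFun {ι κ : Type*} [Fintype κ] (A : Matrix ι κ ℝ) (x : ℕ → κ → ℝ) (i : ι)
    (k : ℕ) : PowerSeries.coeff k ((A.map (PowerSeries.C (R := ℝ))).mulVec (genFun x) i) =
      A.mulVec (x k) i := by
  simp [Matrix.mulVec, dotProduct, genFun]

-- Since `x 0 = 0`, the generating functions satisfy `x = w (A x + B u)` with `w` the power series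
-- variable. The Gram determinant is a polynomial in `w` that is nonzero at `w = 1`, hence nonzero
-- as a power series, and the kernel argument applies over that domain.
open Polynomial in
theorem leftInvertible_of_systemGram_ne_zero {A : Matrix X X ℝ} {B : Matrix X U ℝ}
    {C : Matrix Y X ℝ} {D : Matrix Y U ℝ} (h : systemGram 1 A B C D ≠ 0) :
    LeftInvertible A B C D := by
  intro x u y hx0 hx hy hy0
  have hpoly : systemGram (Polynomial.X : ℝ[X]) (A.map Polynomial.C) (B.map Polynomial.C)
      (C.map Polynomial.C) (D.map Polynomial.C) ≠ 0 := by
    intro h0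
    apply h
    have := map_systemGram (Polynomial.evalRingHom (1 : ℝ)) Polynomial.X (A.map Polynomial.C)
      (B.map Polynomial.C) (C.map Polynomial.C) (D.map Polynomial.C)
    rw [h0, map_zero] at this
    simpa [Matrix.map_map, Function.comp_def] using this.symm
  have hps : systemGram (PowerSeries.X : PowerSeries ℝ) (A.map (PowerSeries.C (R := ℝ)))
      (B.map (PowerSeries.C (R := ℝ))) (C.map (PowerSeries.C (R := ℝ)))
      (D.map (PowerSeries.C (R := ℝ))) ≠ 0 := by
    have := map_systemGram (Polynomial.coeToPowerSeries.ringHom (R := ℝ))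
      Polynomial.X (A.map Polynomial.C) (B.map Polynomial.C) (C.map Polynomial.C) (D.map Polynomial.C)
    simp only [Matrix.map_map, Function.comp_def, Polynomial.coeToPowerSeries.ringHom_apply,
      Polynomial.coe_C, Polynomial.coe_X] at this
    rw [← this]
    simpa using hpoly
  have hU : genFun u = 0 := by
    refine eq_zero_of_systemGram_ne_zero hps (x := genFun x) ?_ ?_
    · ext i k
      rw [Pi.smul_apply, smul_eq_mul]
      cases k with
      | zero => simp [genFun, hx0]
      | succ k =>
        rw [PowerSeries.coeff_succ_X_mul, Pi.add_apply, map_add, coeff_mulVec_genFun,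
          coeff_mulVec_genFun]
        simp [genFun, hx k]
    · ext i k
      rw [Pi.add_apply, map_add, coeff_mulVec_genFun, coeff_mulVec_genFun]
      simpa [hy0] using (congrFun (hy k) i).symm
  intro k
  ext i
  simpa [genFun] using congrArg (PowerSeries.coeff k) (congrFun hU i)

end Matrices

theorem realize_add_smul {ι κ : Type*} [DecidableEq ι] [DecidableEq κ] (S : StructMatrix ι κ)
    (a v : S → ℝ) (t : ℝ) : S.realize (a + t • v) = S.realize a + t • S.realize v := by
  ext i j
  simp only [StructMatrix.realize, Matrix.add_apply, Matrix.smul_apply]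
  split_ifs <;> simp

@[fun_prop]
theorem continuous_realize {ι κ : Type*} [DecidableEq ι] [DecidableEq κ] (S : StructMatrix ι κ) :
    Continuous S.realize := by
  refine continuous_matrix fun i j => ?_
  unfold StructMatrix.realize
  split_ifs <;> fun_prop

theorem isAddHaarMeasure_volume_prod {E F : Type*} [NormedAddCommGroup E] [NormedAddCommGroup F]
    [MeasureSpace E] [MeasureSpace F] [BorelSpace E] [BorelSpace F]
    [SecondCountableTopology E] [SecondCountableTopology F]
    [SigmaFinite (volume : Measure E)] [SigmaFinite (volume : Measure F)]
    [(volume : Measure E).IsAddHaarMeasure] [(volume : Measure F).IsAddHaarMeasure] :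
    (volume : Measure (E × F)).IsAddHaarMeasure :=
  inferInstanceAs ((volume : Measure E).prod (volume : Measure F)).IsAddHaarMeasure

/-- If some realization has no nonzero stationary trajectory with zero output, then the structural
system is structurally left invertible. -/
theorem structurallyLeftInvertible_of_realization {X U Y : Type*} [Fintype X] [Fintype U]
    [Fintype Y] [DecidableEq X] [DecidableEq U] [DecidableEq Y]
    {A : StructMatrix X X} {B : StructMatrix X U} {C : StructMatrix Y X} {D : StructMatrix Y U}
    (α : A → ℝ) (β : B → ℝ) (γ : C → ℝ) (δ : D → ℝ)
    (h : ∀ x u, x = (A.realize α).mulVec x + (B.realize β).mulVec u →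
      (C.realize γ).mulVec x + (D.realize δ).mulVec u = 0 → x = 0 ∧ u = 0) :
    StructurallyLeftInvertible A B C D := by
  have : (volume : Measure ((C → ℝ) × (D → ℝ))).IsAddHaarMeasure := isAddHaarMeasure_volume_prod
  have : (volume : Measure ((B → ℝ) × (C → ℝ) × (D → ℝ))).IsAddHaarMeasure :=
    isAddHaarMeasure_volume_prod
  have : (volume : Measure ((A → ℝ) × (B → ℝ) × (C → ℝ) × (D → ℝ))).IsAddHaarMeasure :=
    isAddHaarMeasure_volume_prod
  have key := ae_ne_zero_of_polynomial_on_lines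
    (volume : Measure ((A → ℝ) × (B → ℝ) × (C → ℝ) × (D → ℝ)))
    (f := fun θ => systemGram 1 (A.realize θ.1) (B.realize θ.2.1) (C.realize θ.2.2.1)
      (D.realize θ.2.2.2)) (by unfold systemGram systemMatrix; fun_prop) (α, β, γ, δ)
    (systemGram_ne_zero h) (by
      rintro ⟨a, b, c, d⟩
      -- Here the polynomial variable is the parameter `t` of the line; `w` stays equal to 1.
      refine ⟨systemGram 1 ((A.realize α).map Polynomial.C + (Polynomial.X : Polynomial ℝ) •
          (A.realize a).map Polynomial.C)
        ((B.realize β).map Polynomial.C + (Polynomial.X : Polynomial ℝ) •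
          (B.realize b).map Polynomial.C)
        ((C.realize γ).map Polynomial.C + (Polynomial.X : Polynomial ℝ) •
          (C.realize c).map Polynomial.C)
        ((D.realize δ).map Polynomial.C + (Polynomial.X : Polynomial ℝ) •
          (D.realize d).map Polynomial.C), fun t => ?_⟩
      rw [← Polynomial.coe_evalRingHom, map_systemGram]
      simp only [map_one]
      congr 1
      · ext i j; simp [realize_add_smul, mul_comm t]
      · ext i j; simp [realize_add_smul, mul_comm t]
      · ext i j; simp [realize_add_smul, mul_comm t]
      · ext i j; simp [realize_add_smul, mul_comm t])
  filter_upwards [key] with θ hθ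
  exact leftInvertible_of_systemGram_ne_zero hθ

/-! ### Attack inputs and undetectable attacks -/

section Attack

variable {n m : ℕ} (F : Finset (Node n m))

theorem mem_attackB {F : Finset (Node n m)} {e : Fin n × F} :
    e ∈ attackB F ↔ e.2.1 = Sum.inl e.1 := by
  simp [attackB]

theorem mem_attackD {F : Finset (Node n m)} {e : Fin m × F} :
    e ∈ attackD F ↔ e.2.1 = Sum.inr e.1 := by
  simp [attackD]

theorem attackB_mulVec_of_notMem (β : attackB F → ℝ) (u : F → ℝ) {i : Fin n}
    (h : Sum.inl i ∉ F) : ((attackB F).realize β).mulVec u i = 0 := by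
  refine Finset.sum_eq_zero fun v _ => ?_
  have : (i, v) ∉ attackB F := fun hv => h (mem_attackB.1 hv ▸ v.2)
  simp [StructMatrix.realize, this]

theorem attackB_mulVec_of_mem (β : attackB F → ℝ) (u : F → ℝ) {i : Fin n} (h : Sum.inl i ∈ F) :
    ((attackB F).realize β).mulVec u i =
      β ⟨(i, ⟨Sum.inl i, h⟩), mem_attackB.2 rfl⟩ * u ⟨Sum.inl i, h⟩ := by
  refine (Finset.sum_eq_single (⟨Sum.inl i, h⟩ : F) (fun v _ hv => ?_) (by simp)).trans ?_
  · have : (i, v) ∉ attackB F := fun hv' => hv (Subtype.ext (mem_attackB.1 hv'))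
    simp [StructMatrix.realize, this]
  · have : (i, (⟨Sum.inl i, h⟩ : F)) ∈ attackB F := mem_attackB.2 rfl
    simp [StructMatrix.realize, this]

theorem attackD_mulVec_of_notMem (δ : attackD F → ℝ) (u : F → ℝ) {i : Fin m}
    (h : Sum.inr i ∉ F) : ((attackD F).realize δ).mulVec u i = 0 := by
  refine Finset.sum_eq_zero fun v _ => ?_
  have : (i, v) ∉ attackD F := fun hv => h (mem_attackD.1 hv ▸ v.2)
  simp [StructMatrix.realize, this]

theorem attackD_mulVec_of_mem (δ : attackD F → ℝ) (u : F → ℝ) {i : Fin m} (h : Sum.inr i ∈ F) :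
    ((attackD F).realize δ).mulVec u i =
      δ ⟨(i, ⟨Sum.inr i, h⟩), mem_attackD.2 rfl⟩ * u ⟨Sum.inr i, h⟩ := by
  refine (Finset.sum_eq_single (⟨Sum.inr i, h⟩ : F) (fun v _ hv => ?_) (by simp)).trans ?_
  · have : (i, v) ∉ attackD F := fun hv' => hv (Subtype.ext (mem_attackD.1 hv'))
    simp [StructMatrix.realize, this]
  · have : (i, (⟨Sum.inr i, h⟩ : F)) ∈ attackD F := mem_attackD.2 rfl
    simp [StructMatrix.realize, this]

theorem eq_zero_of_attack_mulVec_eq_zero {β : attackB F → ℝ} {δ : attackD F → ℝ} {u : F → ℝ}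
    (hβ : ∀ e, β e ≠ 0) (hδ : ∀ e, δ e ≠ 0) (hB : ((attackB F).realize β).mulVec u = 0)
    (hD : ((attackD F).realize δ).mulVec u = 0) : u = 0 := by
  ext ⟨v, hv⟩
  cases v with
  | inl i =>
    have := (attackB_mulVec_of_mem F β u hv).symm.trans (congrFun hB i)
    exact (mul_eq_zero.1 this).resolve_left (hβ _)
  | inr i =>
    have := (attackD_mulVec_of_mem F δ u hv).symm.trans (congrFun hD i)
    exact (mul_eq_zero.1 this).resolve_left (hδ _)

/-- The attacker can inject any pair of vectors supported on the compromised nodes. -/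
theorem exists_attack {β : attackB F → ℝ} {δ : attackD F → ℝ}
    (hβ : ∀ e, β e ≠ 0) (hδ : ∀ e, δ e ≠ 0) (a : Fin n → ℝ) (c : Fin m → ℝ)
    (ha : ∀ i, a i ≠ 0 → Sum.inl i ∈ F) (hc : ∀ i, c i ≠ 0 → Sum.inr i ∈ F) :
    ∃ u, ((attackB F).realize β).mulVec u = a ∧ ((attackD F).realize δ).mulVec u = c := by
  let u : F → ℝ
    | ⟨Sum.inl i, h⟩ => a i / β ⟨(i, ⟨Sum.inl i, h⟩), mem_attackB.2 rfl⟩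
    | ⟨Sum.inr i, h⟩ => c i / δ ⟨(i, ⟨Sum.inr i, h⟩), mem_attackD.2 rfl⟩
  refine ⟨u, funext fun i => ?_, funext fun i => ?_⟩
  · by_cases h : Sum.inl i ∈ F
    · rw [attackB_mulVec_of_mem F β u h]
      exact mul_div_cancel₀ _ (hβ _)
    · rw [attackB_mulVec_of_notMem F β u h]
      by_contra h0
      exact h (ha i (Ne.symm h0))
  · by_cases h : Sum.inr i ∈ F
    · rw [attackD_mulVec_of_mem F δ u h]
      exact mul_div_cancel₀ _ (hδ _)
    · rw [attackD_mulVec_of_notMem F δ u h]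
      by_contra h0
      exact h (hc i (Ne.symm h0))

/-- A set of full measure is dense, so it meets the nonempty open set where all attack gains are
nonzero. -/
theorem exists_leftInvertible_realization {A : StructMatrix (Fin n) (Fin n)} {C : StructMatrix (Fin m) (Fin n)}
    (h : StructurallyLeftInvertible A (attackB F) C (attackD F)) :
    ∃ α β γ δ, (∀ e, β e ≠ 0) ∧ (∀ e, δ e ≠ 0) ∧ LeftInvertible (A.realize α)
      ((attackB F).realize β) (C.realize γ) ((attackD F).realize δ) := by
  have hopen : IsOpen {θ : (A → ℝ) × (attackB F → ℝ) × (C → ℝ) × (attackD F → ℝ) |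
      (∀ e, θ.2.1 e ≠ 0) ∧ ∀ e, θ.2.2.2 e ≠ 0} := by
    simp only [Set.ofPred_and, Set.ofPred_forall]
    exact (isOpen_iInter_of_finite fun e => isOpen_ne_fun (by fun_prop) (by fun_prop)).inter
      (isOpen_iInter_of_finite fun e => isOpen_ne_fun (by fun_prop) (by fun_prop))
  have : (volume : Measure ((C → ℝ) × (attackD F → ℝ))).IsAddHaarMeasure :=
    isAddHaarMeasure_volume_prod
  have : (volume : Measure ((attackB F → ℝ) × (C → ℝ) × (attackD F → ℝ))).IsAddHaarMeasure :=
    isAddHaarMeasure_volume_prod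
  have : (volume : Measure ((A → ℝ) × (attackB F → ℝ) × (C → ℝ) ×
      (attackD F → ℝ))).IsAddHaarMeasure := isAddHaarMeasure_volume_prod
  obtain ⟨θ, ⟨hβ, hδ⟩, hθ⟩ := (Measure.dense_of_ae h).inter_open_nonempty _ hopen
    ⟨(1, 1, 1, 1), by simp⟩
  exact ⟨θ.1, θ.2.1, θ.2.2.1, θ.2.2.2, hβ, hδ, hθ⟩

/-- The system is not structurally left invertible when an agent and all its out-neighbours are
compromised. -/
theorem not_structurallyLeftInvertible_of_outNeighbours
    {A : StructMatrix (Fin n) (Fin n)} {C : StructMatrix (Fin m) (Fin n)} (j : Fin n)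
    (hj : Sum.inl j ∈ F) (hA : ∀ k, (k, j) ∈ A → Sum.inl k ∈ F)
    (hC : ∀ i, (i, j) ∈ C → Sum.inr i ∈ F) :
    ¬ StructurallyLeftInvertible A (attackB F) C (attackD F) := by
  intro h
  obtain ⟨α, β, γ, δ, hβ, hδ, hL⟩ := exists_leftInvertible_realization F h
  -- `u₀` at time 0 creates the state `Pi.single j 1`; `u₁` at time 1 cancels its effect on both the
  -- next state and the output.
  obtain ⟨u₀, hB₀, hD₀⟩ := exists_attack F hβ hδ (Pi.single j 1) 0
    (fun i hi => by
      by_cases hij : i = j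
      · exact hij ▸ hj
      · simp [hij] at hi) (by simp)
  obtain ⟨u₁, hB₁, hD₁⟩ := exists_attack F hβ hδ (-((A.realize α).mulVec (Pi.single j 1)))
    (-((C.realize γ).mulVec (Pi.single j 1)))
    (fun i hi => hA i (by
      by_contra hij
      simp [StructMatrix.realize, hij] at hi))
    (fun i hi => hC i (by
      by_contra hij
      simp [StructMatrix.realize, hij] at hi))
  have hu := hL (fun k => if k = 1 then Pi.single j 1 else 0)
    (fun k => if k = 0 then u₀ else if k = 1 then u₁ else 0) (fun _ => 0) (by simp)
    (fun k => by
      rcases k with _ | _ | k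
      · simp [hB₀]
      · simp [hB₁]
      · simp)
    (fun k => by
      rcases k with _ | _ | k
      · simp [hD₀]
      · simp [hD₁]
      · simp) (fun _ => rfl) 0
  simp only [if_true] at hu
  rw [hu, Matrix.mulVec_zero] at hB₀
  simpa using congrFun hB₀ j

end Attack

/-! ### Out-degree bound and edge counting -/

variable {n m p : ℕ}

theorem lt_outDegree {A : StructMatrix (Fin n) (Fin n)} {C : StructMatrix (Fin m) (Fin n)}
    (h : Feasible p A C) (j : Fin n) : p < outDegree A C j := by
  by_contra! hlt
  -- `F` is exactly the out-neighbourhood of `j`; it contains `j` by the self loop.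
  refine not_structurallyLeftInvertible_of_outNeighbours ((Finset.univ.filter fun k : Fin n =>
    (k, j) ∈ A).disjSum (Finset.univ.filter fun i : Fin m => (i, j) ∈ C)) j ?_ ?_ ?_
    (h.2.2 _ (by rw [Finset.card_disjSum]; exact hlt))
  · simpa using h.1 j
  · simp
  · simp

theorem sum_outDegree {A : StructMatrix (Fin n) (Fin n)} {C : StructMatrix (Fin m) (Fin n)}
    (hC : DedicatedSensors C) : ∑ j, outDegree A C j = A.card + m := by
  have hcol : ∀ {l : ℕ} (S : StructMatrix (Fin l) (Fin n)),
      ∑ j, (Finset.univ.filter fun k : Fin l => (k, j) ∈ S).card = S.card := by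
    intro l S
    rw [Finset.card_eq_sum_card_fiberwise (f := Prod.snd) (t := Finset.univ) (by simp)]
    refine Finset.sum_congr rfl fun j _ => ?_
    refine Finset.card_bij (fun k _ => (k, j)) (by simp) (by simp) ?_
    rintro ⟨k, j'⟩ h
    simp only [Finset.mem_filter] at h
    exact ⟨k, by simpa [← h.2] using h.1, by rw [← h.2]⟩
  have hm : C.card = m := by
    rw [Finset.card_eq_sum_card_fiberwise (f := Prod.fst) (t := Finset.univ) (by simp)]
    refine (Finset.sum_congr rfl fun i _ => ?_).trans
      (by rw [Finset.sum_const, Finset.card_fin, smul_eq_mul, mul_one] : ∑ _i : Fin m, 1 = m)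
    obtain ⟨j, hj, huniq⟩ := hC.1 i
    refine Finset.card_eq_one.2 ⟨(i, j), ?_⟩
    ext ⟨i', j'⟩
    simp only [Finset.mem_filter, Finset.mem_singleton, Prod.mk.injEq]
    constructor
    · rintro ⟨h, rfl⟩
      exact ⟨rfl, huniq _ h⟩
    · rintro ⟨rfl, rfl⟩
      exact ⟨hj, rfl⟩
  simp only [outDegree, Finset.sum_add_distrib, hcol, hm]

/-! ### Matchings and the explicit designs -/

/-- Some observer outside the compromised set `F` measures the agent `k`. -/
def HasIntactSensor (C : StructMatrix (Fin m) (Fin n)) (F : Finset (Node n m)) (k : Fin n) : Prop :=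
  ∃ i, (i, k) ∈ C ∧ Sum.inr i ∉ F

theorem realize_one_mulVec_of_mem {C : StructMatrix (Fin m) (Fin n)} (hC : DedicatedSensors C)
    {i : Fin m} {j : Fin n} (h : (i, j) ∈ C) (x : Fin n → ℝ) :
    (C.realize 1).mulVec x i = x j := by
  rw [Matrix.mulVec, dotProduct, Finset.sum_eq_single j (fun k _ hk => ?_) (by simp)]
  rotate_left
  · have : (i, k) ∉ C := fun h' => hk ((hC.1 i).unique h' h)
    simp [StructMatrix.realize, this]
  · simp [StructMatrix.realize, h]

open Classical in
/-- If the compromised agents without an intact sensor can be matched along edges with distinct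
uncompromised agents with an intact sensor, then the system is structurally left invertible. -/
theorem structurallyLeftInvertible_of_matching {A : StructMatrix (Fin n) (Fin n)}
    {C : StructMatrix (Fin m) (Fin n)} (hC : DedicatedSensors C) (F : Finset (Node n m))
    (φ : {j // Sum.inl j ∈ F ∧ ¬ HasIntactSensor C F j} → Fin n) (hinj : Function.Injective φ)
    (hA : ∀ j, (φ j, j.1) ∈ A) (hF : ∀ j, Sum.inl (φ j) ∉ F)
    (hφ : ∀ j, HasIntactSensor C F (φ j)) :
    StructurallyLeftInvertible A (attackB F) C (attackD F) := by
  -- Only matching edges get weight 1; every other edge, self loops included, gets 0.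
  let α : A → ℝ := fun e => if ∃ h, e.1.1 = φ ⟨e.1.2, h⟩ then 1 else 0
  have hα : ∀ i j, A.realize α i j = if ∃ h, i = φ ⟨j, h⟩ then 1 else 0 := by
    intro i j
    by_cases h : ∃ h, i = φ ⟨j, h⟩
    · have : (i, j) ∈ A := by
        obtain ⟨h, rfl⟩ := h
        exact hA ⟨j, h⟩
      simp [StructMatrix.realize, this, α]
    · simp [StructMatrix.realize, h, α]
  refine structurallyLeftInvertible_of_realization α 1 1 1 fun x u hx hy => ?_
  have hintact : ∀ k, HasIntactSensor C F k → x k = 0 := by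
    rintro k ⟨i, hik, hi⟩
    have := congrFun hy i
    rwa [Pi.add_apply, realize_one_mulVec_of_mem hC hik, attackD_mulVec_of_notMem F _ u hi,
      add_zero] at this
  -- Row `φ j` of the stationary equation reads `x (φ j) = x j`, and the left side is seen to vanish
  -- by an intact sensor.
  have hbad : ∀ j, Sum.inl j ∈ F ∧ ¬ HasIntactSensor C F j → x j = 0 := by
    intro j hj
    have := congrFun hx (φ ⟨j, hj⟩)
    rw [Pi.add_apply, attackB_mulVec_of_notMem F _ u (hF _), hintact _ (hφ _), add_zero,
      Matrix.mulVec, dotProduct, Finset.sum_eq_single j] at this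
    · rw [hα, if_pos ⟨hj, rfl⟩, one_mul] at this
      exact this.symm
    · intro k _ hk
      rw [hα, if_neg, zero_mul]
      rintro ⟨h, h'⟩
      exact hk (congrArg Subtype.val (hinj h')).symm
    · simp
  have hAx : (A.realize α).mulVec x = 0 := by
    ext i
    rw [Matrix.mulVec, dotProduct]
    refine Finset.sum_eq_zero fun j _ => ?_
    rw [hα]
    split_ifs with h
    · rw [hbad j h.1, mul_zero]
    · exact zero_mul _
  rw [hAx, zero_add] at hx
  have hx0 : x = 0 := by
    ext i
    by_cases hi : Sum.inl i ∈ F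
    · by_cases h : HasIntactSensor C F i
      · exact hintact i h
      · exact hbad i ⟨hi, h⟩
    · rw [hx, attackB_mulVec_of_notMem F _ u hi]
      rfl
  subst hx0
  rw [Matrix.mulVec_zero, zero_add] at hy
  exact ⟨rfl, eq_zero_of_attack_mulVec_eq_zero F (by simp) (by simp) hx.symm hy⟩

-- The extra 1 is the edge to the observer if `j` is observed, and the self loop otherwise.
open Classical in
theorem card_observed_outNeighbours {A : StructMatrix (Fin n) (Fin n)}
    {C : StructMatrix (Fin m) (Fin n)} (hC : DedicatedSensors C) (hself : HasSelfLoops A)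
    (hobs : ∀ j k, (k, j) ∈ A → k = j ∨ Observed C k) (j : Fin n) :
    outDegree A C j =
      (Finset.univ.filter fun k : Fin n => (k, j) ∈ A ∧ Observed C k).card + 1 := by
  by_cases hj : Observed C j
  · obtain ⟨i, hi⟩ := hj
    have h1 : (Finset.univ.filter fun i : Fin m => (i, j) ∈ C) = {i} := by
      ext i'
      simp only [Finset.mem_filter, Finset.mem_univ, true_and, Finset.mem_singleton]
      exact ⟨fun h => hC.2 _ _ _ h hi, fun h => h ▸ hi⟩
    rw [outDegree, h1, Finset.card_singleton]
    congr 2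
    ext k
    simp only [Finset.mem_filter, Finset.mem_univ, true_and]
    refine ⟨fun h => ⟨h, ?_⟩, fun h => h.1⟩
    rcases hobs j k h with rfl | h'
    · exact ⟨i, hi⟩
    · exact h'
  · have h1 : (Finset.univ.filter fun i : Fin m => (i, j) ∈ C) = ∅ :=
      Finset.filter_eq_empty_iff.2 fun i _ h => hj ⟨i, h⟩
    have h2 : (Finset.univ.filter fun k : Fin n => (k, j) ∈ A) =
        insert j (Finset.univ.filter fun k : Fin n => (k, j) ∈ A ∧ Observed C k) := by
      ext k
      simp only [Finset.mem_filter, Finset.mem_univ, true_and, Finset.mem_insert]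
      constructor
      · intro h
        exact (hobs j k h).imp_right fun h' => ⟨h, h'⟩
      · rintro (rfl | h)
        · exact hself _
        · exact h.1
    rw [outDegree, h1, h2, Finset.card_empty, Finset.card_insert_of_notMem (by simp [hj])]

open Classical in
theorem robustToAttacks_of_isExplicitDesign {A : StructMatrix (Fin n) (Fin n)}
    {C : StructMatrix (Fin m) (Fin n)} (hC : DedicatedSensors C) (h : IsExplicitDesign p A C) :
    RobustToAttacks p A C := by
  obtain ⟨hself, hobs, hdeg⟩ := h
  intro F hF
  choose c hc _ using hC.1
  let bad := Finset.univ.filter fun j : Fin n => Sum.inl j ∈ F ∧ ¬ HasIntactSensor C F j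
  let good := Finset.univ.filter fun j : Fin n => Sum.inl j ∈ F ∧ HasIntactSensor C F j
  let FY := Finset.univ.filter fun i : Fin m => Sum.inr i ∈ F
  let N : Fin n → Finset (Fin n) := fun j =>
    Finset.univ.filter fun k => (k, j) ∈ A ∧ Sum.inl k ∉ F ∧ HasIntactSensor C F k
  have hcardF : bad.card + good.card + FY.card = F.card := by
    have hsplit : F = (Finset.univ.filter fun j : Fin n => Sum.inl j ∈ F).disjSum FY := by
      ext (v | v) <;> simp [FY]
    have hagents := Finset.card_filter_add_card_filter_not
      (s := Finset.univ.filter fun j : Fin n => Sum.inl j ∈ F) (fun j => HasIntactSensor C F j)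
    simp only [Finset.filter_filter] at hagents
    have := congrArg Finset.card hsplit
    rw [Finset.card_disjSum] at this
    simp only [bad, good]
    omega
  have hN : ∀ j ∈ bad, bad.card ≤ (N j).card := by
    intro j hj
    -- Of the `p` observed out-neighbours, at most `FY.card` lose their sensor and at most
    -- `good.card` are compromised with an intact one. At least `p - FY.card - good.card ≥ bad.card`
    -- remain.
    have hsub : (Finset.univ.filter fun k : Fin n => (k, j) ∈ A ∧ Observed C k) ⊆
        N j ∪ good ∪ FY.image c := by
      intro k hk
      simp only [Finset.mem_filter, Finset.mem_univ, true_and] at hk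
      obtain ⟨hkA, i, hi⟩ := hk
      simp only [N, good, FY, Finset.mem_union, Finset.mem_filter, Finset.mem_univ, true_and,
        Finset.mem_image]
      by_cases hiF : Sum.inr i ∈ F
      · exact Or.inr ⟨i, hiF, (hC.1 i).unique (hc i) hi⟩
      · have hk' : HasIntactSensor C F k := ⟨i, hi, hiF⟩
        by_cases hkF : Sum.inl k ∈ F
        · exact Or.inl (Or.inr ⟨hkF, hk'⟩)
        · exact Or.inl (Or.inl ⟨hkA, hkF, hk'⟩)
    have h1 := Finset.card_le_card hsub
    have h2 := Finset.card_union_le (N j ∪ good) (FY.image c)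
    have h3 := Finset.card_union_le (N j) good
    have h4 := Finset.card_image_le (s := FY) (f := c)
    have h5 := card_observed_outNeighbours hC hself hobs j
    have h6 := hdeg j
    omega
  -- Hall's condition is immediate, since each single neighbourhood already has at least `bad.card`
  -- elements.
  obtain ⟨φ, hinj, hφ⟩ := (Finset.all_card_le_biUnion_card_iff_exists_injective
    fun j : {j // Sum.inl j ∈ F ∧ ¬ HasIntactSensor C F j} => N j.1).1 (by
      intro s
      rcases s.eq_empty_or_nonempty with rfl | ⟨j, hj⟩
      · simp
      · calc s.card = (s.map (Function.Embedding.subtype _)).card := (Finset.card_map _).symm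
          _ ≤ bad.card := Finset.card_le_card fun k hk => by
              obtain ⟨k, _, rfl⟩ := Finset.mem_map.1 hk
              exact Finset.mem_filter.2 ⟨Finset.mem_univ _, k.2⟩
          _ ≤ (N j.1).card := hN j (Finset.mem_filter.2 ⟨Finset.mem_univ _, j.2⟩)
          _ ≤ _ := Finset.card_le_card
              (Finset.subset_biUnion_of_mem (fun j : {j // _} => N j.1) hj))
  have hφ' := fun j => (Finset.mem_filter.1 (hφ j)).2
  exact structurallyLeftInvertible_of_matching hC F φ hinj (fun j => (hφ' j).1)
    (fun j => (hφ' j).2.1) fun j => (hφ' j).2.2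

open Classical in
theorem exists_isExplicitDesign (hp : 1 ≤ p) (hpm : p ≤ m) {C : StructMatrix (Fin m) (Fin n)}
    (hC : DedicatedSensors C) : ∃ A, IsExplicitDesign p A C := by
  choose c hc _ using hC.1
  have hcinj : Function.Injective c := fun i i' h => hC.2 _ _ _ (hc i) (h ▸ hc i')
  have hobs : (Finset.univ.filter fun k : Fin n => Observed C k).card = m := by
    have : (Finset.univ.filter fun k : Fin n => Observed C k) = Finset.univ.image c := by
      ext k
      simp only [Finset.mem_filter, Finset.mem_univ, true_and, Finset.mem_image]
      exact ⟨fun ⟨i, hi⟩ => ⟨i, (hC.1 i).unique (hc i) hi⟩, fun ⟨i, hi⟩ => ⟨i, hi ▸ hc i⟩⟩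
    rw [this, Finset.card_image_of_injective _ hcinj, Finset.card_fin]
  -- An observed `j` must lie in its own `N`, so that its self loop is one of the `p` edges; `1 ≤ p`
  -- makes room for it.
  have hN : ∀ j : Fin n, ∃ N : Finset (Fin n), (∀ k ∈ N, Observed C k) ∧
      (Observed C j → j ∈ N) ∧ N.card = p := by
    intro j
    obtain ⟨N, h1, h2, h3⟩ := Finset.exists_subsuperset_card_eq
      (s := ({j} : Finset (Fin n)).filter fun k => Observed C k)
      (t := Finset.univ.filter fun k : Fin n => Observed C k)
      (Finset.filter_subset_filter _ (Finset.subset_univ _))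
      ((Finset.card_filter_le _ _).trans (by simpa using hp)) (hpm.trans hobs.ge)
    exact ⟨N, fun k hk => (Finset.mem_filter.1 (h2 hk)).2, fun hj => h1 (by simp [hj]), h3⟩
  choose N hNobs hNself hNcard using hN
  let A : StructMatrix (Fin n) (Fin n) :=
    Finset.univ.filter fun e => e.1 = e.2 ∨ e.1 ∈ N e.2
  have hA : ∀ k j, (k, j) ∈ A ↔ k = j ∨ k ∈ N j := by simp [A]
  have hself : HasSelfLoops A := fun j => (hA j j).2 (Or.inl rfl)
  have hAobs : ∀ j k, (k, j) ∈ A → k = j ∨ Observed C k := fun j k h =>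
    ((hA k j).1 h).imp_right (hNobs j k)
  refine ⟨A, hself, hAobs, fun j => ?_⟩
  rw [card_observed_outNeighbours hC hself hAobs j, ← hNcard j]
  congr 2
  ext k
  simp only [Finset.mem_filter, Finset.mem_univ, true_and, hA]
  constructor
  · rintro ⟨rfl | h, h'⟩
    · exact hNself _ h'
    · exact h
  · exact fun h => ⟨Or.inr h, hNobs j k h⟩

theorem exists_dedicatedSensors (hmn : m ≤ n) :
    ∃ C : StructMatrix (Fin m) (Fin n), DedicatedSensors C := by
  refine ⟨Finset.univ.filter fun e => e.2 = Fin.castLE hmn e.1, fun i => ?_, fun i i' j h h' => ?_⟩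
  · simp
  · simp only [Finset.mem_filter, Finset.mem_univ, true_and] at h h'
    exact Fin.castLE_injective hmn (h.symm.trans h')

end StructuralAttack

theorem mainTheorem3 (n m p : ℕ) (hp : 1 ≤ p) (hpm : p ≤ m) (hmn : m ≤ n) :
    IsLeast
      {k : ℕ | ∃ (A : StructuralAttack.StructMatrix (Fin n) (Fin n))
          (C : StructuralAttack.StructMatrix (Fin m) (Fin n)),
          StructuralAttack.Feasible p A C ∧ A.card = k}
      (m * p + (n - m) * (p + 1)) ∧
    m * p + (n - m) * (p + 1) = n * p + n - m ∧
    (∀ C : StructuralAttack.StructMatrix (Fin m) (Fin n), StructuralAttack.DedicatedSensors C →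
      (∃ A : StructuralAttack.StructMatrix (Fin n) (Fin n),
        StructuralAttack.IsExplicitDesign p A C) ∧
      ∀ A : StructuralAttack.StructMatrix (Fin n) (Fin n),
        StructuralAttack.IsExplicitDesign p A C →
          StructuralAttack.Feasible p A C ∧ A.card = m * p + (n - m) * (p + 1)) := by
  -- Adding `m` gives the total of all out-degrees when each equals `p + 1`, and avoids a truncated
  -- subtraction.
  have hcount : m * p + (n - m) * (p + 1) + m = n * (p + 1) := by
    obtain ⟨l, rfl⟩ := Nat.exists_eq_add_of_le hmn
    rw [Nat.add_sub_cancel_left]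
    ring
  have hexplicit : ∀ C : StructuralAttack.StructMatrix (Fin m) (Fin n),
      StructuralAttack.DedicatedSensors C →
      ∀ A : StructuralAttack.StructMatrix (Fin n) (Fin n),
        StructuralAttack.IsExplicitDesign p A C →
          StructuralAttack.Feasible p A C ∧ A.card = m * p + (n - m) * (p + 1) := by
    intro C hC A hA
    refine ⟨⟨hA.1, hC, StructuralAttack.robustToAttacks_of_isExplicitDesign hC hA⟩, ?_⟩
    have := StructuralAttack.sum_outDegree (A := A) hC
    simp only [hA.2.2, Finset.sum_const, Finset.card_univ, Fintype.card_fin, smul_eq_mul] at this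
    omega
  refine ⟨⟨?_, ?_⟩, by have : n * (p + 1) = n * p + n := Nat.mul_succ n p; omega, fun C hC =>
    ⟨StructuralAttack.exists_isExplicitDesign hp hpm hC, hexplicit C hC⟩⟩
  · obtain ⟨C, hC⟩ := StructuralAttack.exists_dedicatedSensors hmn
    obtain ⟨A, hA⟩ := StructuralAttack.exists_isExplicitDesign hp hpm hC
    exact ⟨A, C, hexplicit C hC A hA⟩
  · rintro k ⟨A, C, h, rfl⟩
    have hsum := StructuralAttack.sum_outDegree (A := A) h.2.1
    have hle : ∑ _j : Fin n, (p + 1) ≤ ∑ j, StructuralAttack.outDegree A C j :=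
      Finset.sum_le_sum fun j _ => StructuralAttack.lt_outDegree h j
    simp only [Finset.sum_const, Finset.card_univ, Fintype.card_fin, smul_eq_mul] at hle
    omega
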